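/- Let $d\ge 3$ and $N\ge 2$. Let $\tau$ be the function on $\{1,\dots,N\}^d$ with $\tau(\mathbf i)=N^{-(d-1)}$ if $N$ divides $\sum_{j=1}^d (i_j-1)$, and $\tau(\mathbf i)=0$ otherwise. For $1\le j\le d$ and $0\le k\le N$ put $a^j_k=\sum_{\mathbf i:\,i_j\le k}\tau(\mathbf i)$; for $1\le k\le N$ put $E^j_k=[a^j_{k-1},a^j_k]$; and let $f_{\mathbf i}$ be the affine map whose $j$-th coordinate is $a^j_{i_j-1}+(a^j_{i_j}-a^j_{i_j-1})\,x_j$. Write $\lambda_n$ for Lebesgue measure on $[0,1]^n$. Then $\tau\in\mathcal U_d^N$, that is: $\tau$ is a probability distribution; $\sum_{\mathbf i:\,i_j=k}\tau(\mathbf i)>0$ and $E^j_k=[\frac{k-1}{N},\frac kN]$ for all $1\le j\le d$ and $1\le k\le N$; and for every coordinate $j_0$ and all $i_j\in\{1,\dots,N\}$ ($j\ne j_0$), $$\sum_{l=1}^N\tau(i_1,\dots,i_{j_0-1},l,i_{j_0+1},\dots,i_d)=\prod_{j\ne j_0}\lambda_1(E^j_{i_j}).$$ Moreover, there is a unique Borel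 probability measure $\mu^\star_\tau$ on $[0,1]^d$ with $\mu^\star_\tau=\sum_{\mathbf i:\,\tau(\mathbf i)>0}\tau(\mathbf i)\,(f_{\mathbf i})_*\mu^\star_\tau$, and it has the following properties. 1. All one-dimensional marginals of $\mu^\star_\tau$ equal $\lambda_1$, and all its $(d-1)$-dimensional marginals equal $\lambda_{d-1}$. 2. $\mu^\star_\tau$ is singular with respect to $\lambda_d$. Its support is a self-similar set (a nonempty compact set that is the union of its images under finitely many, at least two, similarities with ratios in $(0,1)$) of Hausdorff dimension $d-1$. 3. If $\mathbf X=(X_1,\dots,X_d)$ is a random vector with distribution $\mu^\star_\tau$, then each $X_j$ is almost surely a (Borel measurable) function of the other $d-1$ variables. 4. If $d=3$ and $N=2$, the support of $\mu^\star_\tau$ is a Sierpinski tetrahedron, i.e. the unique nonempty compact set $K$ with $K=\bigcup_{v}\frac12(v+K)$, where $v$ runs over the four vertices of some regular tetrahedron. -/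

import Mathlib

open MeasureTheory Set
open scoped ENNReal

universe u

noncomputable section

namespace SierpinskiCopula

/-- The unit cube `[0,1]^ι`. -/
def unitCube (ι : Type*) : Set (EuclideanSpace ℝ ι) := {x | ∀ j, x j ∈ Icc (0 : ℝ) 1}

/-- Lebesgue measure on the unit cube `[0,1]^ι`, as a measure on the ambient space. -/
def cubeLebesgue (ι : Type*) [Fintype ι] : Measure (EuclideanSpace ℝ ι) :=
  volume.restrict (unitCube ι)

/-- The projection deleting the coordinate `j₀`. -/
def dropCoord {d : ℕ} (j₀ : Fin d) (x : EuclideanSpace ℝ (Fin d)) :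
    EuclideanSpace ℝ {j : Fin d // j ≠ j₀} :=
  WithLp.toLp 2 fun j => x j

/-- `μ` is a probability measure on `[0,1]^d`. -/
structure IsCubeProbability {d : ℕ} (μ : Measure (EuclideanSpace ℝ (Fin d))) : Prop where
  isProbabilityMeasure : IsProbabilityMeasure μ
  compl_cube : μ (unitCube (Fin d))ᶜ = 0

/-- `μ` is `d`-stochastic: a probability measure on `[0,1]^d` whose univariate marginals are all
uniform on `[0,1]`. -/
structure IsStochastic {d : ℕ} (μ : Measure (EuclideanSpace ℝ (Fin d))) : Prop
    extends IsCubeProbability μ where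
  map_coord : ∀ j : Fin d, μ.map (fun x => x j) = volume.restrict (Icc (0 : ℝ) 1)

/-- `μ` is `d`-stochastic and all its `(d-1)`-dimensional marginals are Lebesgue measure on
`[0,1]^(d-1)`. -/
structure HasUniformMarginals {d : ℕ} (μ : Measure (EuclideanSpace ℝ (Fin d))) : Prop
    extends IsStochastic μ where
  map_dropCoord : ∀ j₀ : Fin d, μ.map (dropCoord j₀) = cubeLebesgue {j : Fin d // j ≠ j₀}

/-! Indices in `{1,…,N}^d` are written as functions `Fin d → Fin N`; the digit `k : Fin N`
stands for the index `k + 1`. A distribution on indices is given by its point masses. -/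

/-- Generalized transformation matrices of size `N × ⋯ × N`. -/
structure IsTransformationMatrix {d N : ℕ} (τ : (Fin d → Fin N) → ℝ) : Prop where
  nonneg : ∀ i, 0 ≤ τ i
  sum_eq_one : ∑ i, τ i = 1
  slice_pos : ∀ (j : Fin d) (k : Fin N), 0 < ∑ i with i j = k, τ i

/-- The partition point `a^j_k`, for `0 ≤ k ≤ N`: the mass of the indices whose `j`-th entry,
counted from `1`, is at most `k`. -/
def cut {d N : ℕ} (τ : (Fin d → Fin N) → ℝ) (j : Fin d) (k : ℕ) : ℝ :=
  ∑ i with (i j : ℕ) < k, τ i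

/-- The partition interval in direction `j` belonging to the digit `k`. -/
def cell {d N : ℕ} (τ : (Fin d → Fin N) → ℝ) (j : Fin d) (k : Fin N) : Set ℝ :=
  Icc (cut τ j k) (cut τ j (k + 1))

/-- The uniformity condition with respect to the coordinate `j₀`. -/
def UniformityCondition {d N : ℕ} (τ : (Fin d → Fin N) → ℝ) (j₀ : Fin d) : Prop :=
  ∀ i : Fin d → Fin N,
    ∑ l : Fin N, τ (Function.update i j₀ l) =
      ∏ j ∈ Finset.univ.erase j₀, (volume (cell τ j (i j))).toReal

/-- The class `U_d^N`. -/
structure IsUniformMatrix {d N : ℕ} (τ : (Fin d → Fin N) → ℝ) : Prop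
    extends IsTransformationMatrix τ where
  cell_eq : ∀ (j : Fin d) (k : Fin N), cell τ j k = Icc ((k : ℝ) / N) (((k : ℝ) + 1) / N)
  uniformity : ∀ j₀ : Fin d, UniformityCondition τ j₀

/-- The affine map `f_i` sending `[0,1]^d` onto the rectangle with index `i`. -/
def cellMap {d N : ℕ} (τ : (Fin d → Fin N) → ℝ) (i : Fin d → Fin N)
    (x : EuclideanSpace ℝ (Fin d)) : EuclideanSpace ℝ (Fin d) :=
  WithLp.toLp 2 fun j => cut τ j (i j) + (cut τ j (i j + 1) - cut τ j (i j)) * x j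

/-- The Markov operator `μ ↦ ∑ τ(i) μ^{f_i}`, the sum ranging over the support of `τ`. -/
def markovOperator {d N : ℕ} (τ : (Fin d → Fin N) → ℝ)
    (μ : Measure (EuclideanSpace ℝ (Fin d))) : Measure (EuclideanSpace ℝ (Fin d)) :=
  ∑ i with 0 < τ i, ENNReal.ofReal (τ i) • μ.map (cellMap τ i)

/-- `μ` is a fixed point of the Markov operator among the probability measures on `[0,1]^d`. -/
structure IsInvariantMeasure {d N : ℕ} (τ : (Fin d → Fin N) → ℝ)
    (μ : Measure (EuclideanSpace ℝ (Fin d))) : Prop extends IsCubeProbability μ where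
  fixed : markovOperator τ μ = μ

/-- A self-similar set: a nonempty compact set that is the union of its images under finitely
many (at least two) contracting similarities. -/
def IsSelfSimilar {X : Type*} [MetricSpace X] (K : Set X) : Prop :=
  K.Nonempty ∧ IsCompact K ∧
    ∃ (m : ℕ) (f : Fin m → X → X) (c : Fin m → ℝ), 2 ≤ m ∧
      (∀ l, 0 < c l ∧ c l < 1 ∧ ∀ x y, dist (f l x) (f l y) = c l * dist x y) ∧
      K = ⋃ l, f l '' K

/-- A Sierpinski tetrahedron: the attractor of the four homotheties with ratio `1/2` centred at
the vertices of a regular tetrahedron. -/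
def IsSierpinskiTetrahedron {d : ℕ} (K : Set (EuclideanSpace ℝ (Fin d))) : Prop :=
  ∃ T : Affine.Simplex ℝ (EuclideanSpace ℝ (Fin d)) 3, T.Equilateral ∧
    K.Nonempty ∧ IsCompact K ∧
    K = ⋃ v, AffineMap.homothety (T.points v) (1 / 2 : ℝ) '' K

/-- Mass `1 / N^(d-1)` on every index whose digit sum is divisible by `N`. -/
def digitSumMatrix (d N : ℕ) (i : Fin d → Fin N) : ℝ :=
  if N ∣ ∑ j, (i j : ℕ) then 1 / (N : ℝ) ^ (d - 1) else 0

end SierpinskiCopula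

end

namespace SierpinskiCopula

/-! The condition on an index is one linear equation over `Z/N`: any `d-1` entries are free and
determine the last. So each line sum of the matrix has a single nonzero term, double counting gives
the slice masses, and the maps become `x ↦ (i + x) / N` with digits counted from `0` (`gridMap`).

The same equation is then imposed at every base `N` digit. For `y` in the `(d-1)`-cube, `balancing`
is the number whose digits are minus the digit sums of `y`. Up to null faces, the lift of `y` by
this number intertwines each grid map with the grid map of the completed zero-sum index
(`balancedLift_gridMap`). Lebesgue measure is invariant under all `N^(d-1)` equally weighted grid
maps, so its lift is invariant under the Markov operator, whichever coordinate `j` is balanced.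
Invariant probabilities are unique (`eq_of_selfSimilar`, by characteristic functions), so all these
lifts are one measure. Being the lift along `j` yields both the marginal that omits `j` and the
functional dependence of the `j`-th coordinate.

The support is compact and consists of `N^(d-1)` copies of itself scaled by `1/N`, so its dimension
is at most `d-1`. Its projections contain an open cube, so the dimension is exactly `d-1`, and
singularity follows. -/

/-! ### Uniformity of the digit sum matrix -/

theorem sum_sum_update {ι α M : Type*} [Fintype ι] [DecidableEq ι] [Fintype α]
    [AddCommMonoid M] (F : (ι → α) → M) (j : ι) :
    ∑ i, ∑ l, F (Function.update i j l) = Fintype.card α • ∑ i, F i := by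
  have key : ∀ G : (ι → α) → M, ∑ i, G i =
      ∑ l : α, ∑ i' : {k // k ≠ j} → α, G ((Equiv.funSplitAt j α).symm (l, i')) := by
    intro G
    rw [← (Equiv.funSplitAt j α).symm.sum_comp, Fintype.sum_prod_type]
  have upd : ∀ (l l' : α) (i' : {k // k ≠ j} → α),
      Function.update ((Equiv.funSplitAt j α).symm (l', i')) j l =
        (Equiv.funSplitAt j α).symm (l, i') := by
    intro l l' i'
    ext k
    by_cases h : k = j
    · subst h; simp [Equiv.funSplitAt, Equiv.piSplitAt]
    · simp [Equiv.funSplitAt, Equiv.piSplitAt, h]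
  rw [key, key F]
  simp_rw [upd]
  rw [Finset.sum_const, Finset.card_univ, Finset.sum_comm]

theorem dvd_sum_iff {ι : Type*} [Fintype ι] {N : ℕ} [NeZero N] (i : ι → Fin N) :
    N ∣ ∑ j, (i j : ℕ) ↔ ∑ j, i j = 0 := by
  have h : ∀ s : Finset ι, Fin.ofNat N (∑ j ∈ s, (i j : ℕ)) = ∑ j ∈ s, i j := by
    classical
    intro s
    induction s using Finset.induction_on with
    | empty => simp
    | insert a s ha ih =>
      rw [Finset.sum_insert ha, Finset.sum_insert ha, ← ih]
      ext
      simp [Fin.val_add]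
  rw [← h, Fin.ext_iff]
  simp [Nat.dvd_iff_mod_eq_zero]

theorem digitSumMatrix_eq {d N : ℕ} [NeZero N] (i : Fin d → Fin N) :
    digitSumMatrix d N i = if ∑ j, i j = 0 then 1 / (N : ℝ) ^ (d - 1) else 0 := by
  simp only [digitSumMatrix, dvd_sum_iff]

theorem sum_update_eq_zero_iff {ι α : Type*} [Fintype ι] [DecidableEq ι] [AddCommGroup α]
    (i : ι → α) (j : ι) (l : α) :
    ∑ k, Function.update i j l k = 0 ↔ l = -∑ k ∈ Finset.univ.erase j, i k := by
  rw [Finset.sum_update_of_mem (Finset.mem_univ j), Finset.sdiff_singleton_eq_erase,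
    eq_neg_iff_add_eq_zero]

theorem sum_digitSumMatrix_update {d N : ℕ} [NeZero N] (i : Fin d → Fin N) (j : Fin d) :
    ∑ l, digitSumMatrix d N (Function.update i j l) = 1 / (N : ℝ) ^ (d - 1) := by
  simp [digitSumMatrix_eq, sum_update_eq_zero_iff]

theorem sum_digitSumMatrix_filter {d N : ℕ} [NeZero N] (hd : 2 ≤ d) (j : Fin d)
    (P : Fin N → Prop) [DecidablePred P] :
    ∑ i with P (i j), digitSumMatrix d N i = (Finset.univ.filter P).card / (N : ℝ) := by
  have hN : (N : ℝ) ≠ 0 := Nat.cast_ne_zero.2 (NeZero.ne N)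
  have : Nontrivial (Fin d) := Fin.nontrivial_iff_two_le.2 hd
  obtain ⟨j₀, hj₀⟩ := exists_ne j
  -- Summing along `j₀ ≠ j` replaces the matrix by the constant `1 / N ^ (d - 1)` and leaves the
  -- condition on entry `j` alone; summing along `j` then counts the digits satisfying `P`.
  have h1 := sum_sum_update (fun i : Fin d → Fin N => if P (i j) then digitSumMatrix d N i else 0) j₀
  have h2 := sum_sum_update (fun i : Fin d → Fin N =>
    if P (i j) then 1 / (N : ℝ) ^ (d - 1) else 0) j
  have h3 : ∀ i : Fin d → Fin N,
      (∑ l, if P (Function.update i j₀ l j) then digitSumMatrix d N (Function.update i j₀ l) else 0)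
        = if P (i j) then 1 / (N : ℝ) ^ (d - 1) else 0 := by
    intro i
    simp only [Function.update_of_ne hj₀.symm]
    split_ifs
    · exact sum_digitSumMatrix_update i j₀
    · simp
  beta_reduce at h1
  rw [Finset.sum_congr rfl fun i _ => h3 i] at h1
  simp only [Function.update_self] at h2
  simp only [← Finset.sum_filter] at h1 h2
  simp only [Finset.sum_const, Finset.card_univ, Fintype.card_fun, Fintype.card_fin,
    nsmul_eq_mul] at h1 h2
  rw [h1] at h2
  obtain ⟨e, rfl⟩ : ∃ e, d = e + 1 := ⟨d - 1, by omega⟩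
  push_cast [Nat.add_sub_cancel] at h2
  rw [eq_div_iff hN]
  have h4 : (N : ℝ) ^ (e + 1) * ((Finset.univ.filter P).card * (1 / (N : ℝ) ^ e)) =
    N * (Finset.univ.filter P).card := by field_simp; ring
  rw [h4] at h2
  have := mul_left_cancel₀ hN h2
  linarith

theorem cut_digitSumMatrix {d N : ℕ} [NeZero N] (hd : 2 ≤ d) (j : Fin d) {k : ℕ} (hk : k ≤ N) :
    cut (digitSumMatrix d N) j k = k / N := by
  rw [cut, sum_digitSumMatrix_filter hd j (fun l : Fin N => (l : ℕ) < k), Fin.card_filter_val_lt,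
    min_eq_right hk]

theorem cell_digitSumMatrix {d N : ℕ} [NeZero N] (hd : 2 ≤ d) (j : Fin d) (k : Fin N) :
    cell (digitSumMatrix d N) j k = Icc ((k : ℝ) / N) (((k : ℝ) + 1) / N) := by
  rw [cell, cut_digitSumMatrix hd j k.2.le, cut_digitSumMatrix hd j k.2]
  push_cast
  rfl

theorem isUniformMatrix_digitSumMatrix {d N : ℕ} [NeZero N] (hd : 2 ≤ d) :
    IsUniformMatrix (digitSumMatrix d N) where
  nonneg i := by
    rw [digitSumMatrix]
    split_ifs <;> positivity
  sum_eq_one := by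
    have := sum_digitSumMatrix_filter (N := N) hd ⟨0, by omega⟩ (fun _ => True)
    simpa [NeZero.ne N] using this
  slice_pos j k := by
    have := NeZero.pos N
    rw [sum_digitSumMatrix_filter hd j (fun l => l = k)]
    simpa [Finset.filter_eq'] using this
  cell_eq := cell_digitSumMatrix hd
  uniformity j₀ i := by
    rw [sum_digitSumMatrix_update]
    have : ∀ k : Fin N, (((k : ℝ) + 1) / N - k / N) = 1 / N := fun k => by ring
    simp only [cell_digitSumMatrix hd, Real.volume_Icc, this]
    simp

/-! ### Grid maps and the Markov operator -/

/-- The homothety sending the unit cube onto the cell of the regular grid with index `i`. -/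
noncomputable def gridMap {ι : Type*} {N : ℕ} (i : ι → Fin N) (x : EuclideanSpace ℝ ι) :
    EuclideanSpace ℝ ι :=
  WithLp.toLp 2 fun j => ((i j : ℝ) + x j) / N

theorem gridMap_apply {ι : Type*} {N : ℕ} (i : ι → Fin N) (x : EuclideanSpace ℝ ι) (j : ι) :
    gridMap i x j = ((i j : ℝ) + x j) / N := rfl

theorem gridMap_eq_add_smul {ι : Type*} {N : ℕ} (i : ι → Fin N) (x : EuclideanSpace ℝ ι) :
    gridMap i x = gridMap i 0 + (N : ℝ)⁻¹ • x := by
  ext j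
  simp [gridMap_apply]
  ring

theorem continuous_gridMap {ι : Type*} {N : ℕ} (i : ι → Fin N) :
    Continuous (gridMap i) := by
  unfold gridMap
  fun_prop

theorem cellMap_digitSumMatrix {d N : ℕ} [NeZero N] (hd : 2 ≤ d) (i : Fin d → Fin N) :
    cellMap (digitSumMatrix d N) i = gridMap i := by
  ext x j
  simp only [cellMap, gridMap_apply, cut_digitSumMatrix hd j (i j).2.le,
    cut_digitSumMatrix hd j (i j).2]
  push_cast
  ring

/-- The indices whose entries sum to zero modulo `N`. -/
def zeroSumIndices (d N : ℕ) [NeZero N] : Finset (Fin d → Fin N) := {i | ∑ j, i j = 0}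

theorem mem_zeroSumIndices {d N : ℕ} [NeZero N] {i : Fin d → Fin N} :
    i ∈ zeroSumIndices d N ↔ ∑ j, i j = 0 := by simp [zeroSumIndices]

theorem markovOperator_digitSumMatrix {d N : ℕ} [NeZero N] (hd : 2 ≤ d)
    (μ : Measure (EuclideanSpace ℝ (Fin d))) :
    markovOperator (digitSumMatrix d N) μ =
      ∑ i ∈ zeroSumIndices d N, ENNReal.ofReal (1 / (N : ℝ) ^ (d - 1)) • μ.map (gridMap i) := by
  have hN : 0 < (N : ℝ) := Nat.cast_pos.2 (NeZero.pos N)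
  have h : (Finset.univ.filter fun i => 0 < digitSumMatrix d N i) = zeroSumIndices d N := by
    ext i
    simp only [digitSumMatrix_eq, Finset.mem_filter, Finset.mem_univ, true_and, mem_zeroSumIndices]
    split_ifs with h
    · simp only [h, iff_true]; positivity
    · simp [h]
  rw [markovOperator, h]
  refine Finset.sum_congr rfl fun i hi => ?_
  rw [cellMap_digitSumMatrix hd, digitSumMatrix_eq, if_pos (mem_zeroSumIndices.1 hi)]

theorem card_zeroSumIndices {d N : ℕ} [NeZero N] (hd : 2 ≤ d) :
    (zeroSumIndices d N).card = N ^ (d - 1) := by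
  have hN : (N : ℝ) ≠ 0 := Nat.cast_ne_zero.2 (NeZero.ne N)
  have h := (isUniformMatrix_digitSumMatrix (N := N) hd).sum_eq_one
  simp only [digitSumMatrix_eq, ← Finset.sum_filter, Finset.sum_const, nsmul_eq_mul] at h
  rw [mul_one_div, div_eq_one_iff_eq (by positivity)] at h
  exact_mod_cast h

/-! ### Uniqueness of the invariant measure -/

section Uniqueness

variable {E α : Type*} [NormedAddCommGroup E] [InnerProductSpace ℝ E] [MeasurableSpace E]
  [BorelSpace E] [SecondCountableTopology E]

open Complex in
-- Translations become phases and scaling moves to the argument; the common ratio lets `charFun μ (r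
-- • t)` factor out.
theorem charFun_of_selfSimilar {μ : Measure E} [IsFiniteMeasure μ] (s : Finset α) (p : α → ℝ)
    (hp : ∀ a ∈ s, 0 ≤ p a) (v : α → E) (r : ℝ)
    (hμ : ∑ a ∈ s, ENNReal.ofReal (p a) • μ.map (fun x => v a + r • x) = μ) (t : E) :
    charFun μ t = (∑ a ∈ s, p a * exp (inner ℝ (v a) t * I)) * charFun μ (r • t) := by
  have h1 : ∀ a, charFun (μ.map (fun x => v a + r • x)) t =
      exp (inner ℝ (v a) t * I) * charFun μ (r • t) := by
    intro a
    have : (fun x => v a + r • x) = (v a + ·) ∘ (r • ·) := rfl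
    rw [this, ← Measure.map_map (by fun_prop) (by fun_prop), charFun_map_const_add,
      charFun_map_smul, mul_comm]
  conv_lhs => rw [← hμ]
  rw [charFun_apply, integral_finsetSum_measure, Finset.sum_mul]
  · refine Finset.sum_congr rfl fun a ha => ?_
    rw [integral_smul_measure, ← charFun_apply, h1, ENNReal.toReal_ofReal (hp a ha), mul_assoc]
    rfl
  · intro a _
    refine Integrable.smul_measure ?_ ENNReal.ofReal_ne_top
    refine Integrable.of_bound (C := 1) (by fun_prop) (ae_of_all _ fun x => ?_)
    rw [norm_exp_ofReal_mul_I]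

open Filter Topology in
/-- A probability measure that is invariant under a weighted system of homotheties with a common
ratio of absolute value less than one is determined by the system. -/
theorem eq_of_selfSimilar [CompleteSpace E] {μ ν : Measure E} [IsProbabilityMeasure μ]
    [IsProbabilityMeasure ν] (s : Finset α) (p : α → ℝ) (hp : ∀ a ∈ s, 0 ≤ p a)
    (hp1 : ∑ a ∈ s, p a = 1) (v : α → E) {r : ℝ} (hr : |r| < 1)
    (hμ : ∑ a ∈ s, ENNReal.ofReal (p a) • μ.map (fun x => v a + r • x) = μ)
    (hν : ∑ a ∈ s, ENNReal.ofReal (p a) • ν.map (fun x => v a + r • x) = ν) : μ = ν := by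
  refine Measure.ext_of_charFun (funext fun t => ?_)
  -- Both measures have the same phase sum, a convex combination of unit complex numbers, hence of
  -- modulus at most one.
  have step : ∀ t, ‖charFun μ t - charFun ν t‖ ≤ ‖charFun μ (r • t) - charFun ν (r • t)‖ := by
    intro t
    rw [charFun_of_selfSimilar s p hp v r hμ t, charFun_of_selfSimilar s p hp v r hν t,
      ← mul_sub, norm_mul]
    refine mul_le_of_le_one_left (norm_nonneg _) ((norm_sum_le _ _).trans ?_)
    rw [← hp1]
    refine Finset.sum_le_sum fun a ha => ?_
    rw [norm_mul, Complex.norm_exp_ofReal_mul_I, mul_one, Complex.norm_real, Real.norm_eq_abs,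
      abs_of_nonneg (hp a ha)]
  have iter : ∀ n : ℕ, ‖charFun μ t - charFun ν t‖ ≤
      ‖charFun μ (r ^ n • t) - charFun ν (r ^ n • t)‖ := by
    intro n
    induction n with
    | zero => simp
    | succ n ih =>
      refine ih.trans ((step _).trans_eq ?_)
      rw [smul_smul, pow_succ']
  -- The difference is continuous and vanishes at the origin, where both characteristic functions
  -- are `1`.
  have lim : Tendsto (fun n : ℕ => ‖charFun μ (r ^ n • t) - charFun ν (r ^ n • t)‖) atTop (𝓝 0) := by
    have h0 : Tendsto (fun n : ℕ => r ^ n • t) atTop (𝓝 0) := by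
      simpa using (tendsto_pow_atTop_nhds_zero_of_abs_lt_one hr).smul_const t
    have hc : Continuous fun t => ‖charFun μ t - charFun ν t‖ :=
      (continuous_charFun.sub continuous_charFun).norm
    simpa [Function.comp_def] using (hc.tendsto 0).comp h0
  have := ge_of_tendsto' lim iter
  rw [← sub_eq_zero]
  exact norm_le_zero_iff.1 this

end Uniqueness

theorem gridMap_eq_fun {ι : Type*} {N : ℕ} (i : ι → Fin N) :
    gridMap i = fun x => gridMap i 0 + (N : ℝ)⁻¹ • x := funext (gridMap_eq_add_smul i)

theorem eq_of_markovOperator_eq {d N : ℕ} (hd : 2 ≤ d) (hN : 2 ≤ N)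
    {μ ν : Measure (EuclideanSpace ℝ (Fin d))} [IsProbabilityMeasure μ] [IsProbabilityMeasure ν]
    (hμ : markovOperator (digitSumMatrix d N) μ = μ)
    (hν : markovOperator (digitSumMatrix d N) ν = ν) : μ = ν := by
  have : NeZero N := ⟨by omega⟩
  rw [markovOperator_digitSumMatrix hd] at hμ hν
  have hN' : (1 : ℝ) < N := by exact_mod_cast hN
  refine eq_of_selfSimilar (zeroSumIndices d N) (fun _ => 1 / (N : ℝ) ^ (d - 1))
    (fun _ _ => by positivity) ?_ (fun i => gridMap i 0) (r := (N : ℝ)⁻¹) ?_ ?_ ?_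
  · rw [Finset.sum_const, card_zeroSumIndices hd, nsmul_eq_mul]
    push_cast
    field_simp
  · rw [abs_of_pos (by positivity)]
    exact inv_lt_one_of_one_lt₀ hN'
  · exact (Finset.sum_congr rfl fun i _ => by rw [← gridMap_eq_fun]).trans hμ
  · exact (Finset.sum_congr rfl fun i _ => by rw [← gridMap_eq_fun]).trans hν

/-- The half-open unit cube. -/
def halfOpenCube (ι : Type*) : Set (EuclideanSpace ℝ ι) := {x | ∀ j, x j ∈ Ico (0 : ℝ) 1}

/-! ### Invariance of Lebesgue measure under all grid maps -/

section Lebesgue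

variable {ι : Type*}

theorem isClosed_unitCube : IsClosed (unitCube ι) := by
  simp only [unitCube, ofPred_forall]
  exact isClosed_iInter fun j => isClosed_Icc.preimage (by fun_prop)

/-- The half-open cell of the regular grid with index `i`. -/
def gridCell {N : ℕ} (i : ι → Fin N) : Set (EuclideanSpace ℝ ι) :=
  {x | ∀ j, (N : ℝ) * x j - i j ∈ Ico (0 : ℝ) 1}

theorem gridMap_preimage_gridCell {N : ℕ} [NeZero N] (i : ι → Fin N) :
    gridMap i ⁻¹' gridCell i = halfOpenCube ι := by
  have hN : (N : ℝ) ≠ 0 := Nat.cast_ne_zero.2 (NeZero.ne N)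
  ext x
  simp only [gridCell, halfOpenCube, mem_preimage, mem_ofPred_eq, gridMap_apply]
  refine forall_congr' fun j => ?_
  rw [mul_div_cancel₀ _ hN, add_sub_cancel_left]

theorem mem_gridCell_iff {N : ℕ} {i : ι → Fin N} {x : EuclideanSpace ℝ ι} :
    x ∈ gridCell i ↔ ∀ j, ⌊(N : ℝ) * x j⌋ = (i j : ℤ) := by
  simp only [gridCell, mem_ofPred_eq, mem_Ico, Int.floor_eq_iff]
  refine forall_congr' fun j => ?_
  push_cast
  constructor <;> rintro ⟨h1, h2⟩ <;> constructor <;> linarith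

theorem pairwise_disjoint_gridCell {N : ℕ} :
    Pairwise (Function.onFun Disjoint (gridCell : (ι → Fin N) → Set (EuclideanSpace ℝ ι))) := by
  intro i i' h
  refine Set.disjoint_left.2 fun x hx hx' => h ?_
  ext j
  exact_mod_cast (mem_gridCell_iff.1 hx j).symm.trans (mem_gridCell_iff.1 hx' j)

theorem iUnion_gridCell {N : ℕ} [NeZero N] :
    ⋃ i : ι → Fin N, gridCell i = halfOpenCube ι := by
  have hN : (0 : ℝ) < N := Nat.cast_pos.2 (NeZero.pos N)
  ext x
  simp only [mem_iUnion, halfOpenCube, mem_ofPred_eq]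
  constructor
  · rintro ⟨i, hi⟩ j
    obtain ⟨h1, h2⟩ := hi j
    have h3 : ((i j : ℕ) : ℝ) + 1 ≤ N := by exact_mod_cast (i j).2
    have h4 : (0 : ℝ) ≤ (i j : ℕ) := Nat.cast_nonneg _
    constructor
    · exact nonneg_of_mul_nonneg_right (by linarith) hN
    · exact lt_of_mul_lt_mul_left (by linarith) hN.le
  · intro hx
    have hlt : ∀ j, ⌊(N : ℝ) * x j⌋₊ < N := fun j => by
      rw [Nat.floor_lt (mul_nonneg hN.le (hx j).1)]
      exact mul_lt_of_lt_one_right hN (hx j).2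
    refine ⟨fun j => ⟨_, hlt j⟩, mem_gridCell_iff.2 fun j => ?_⟩
    exact (Int.natCast_floor_eq_floor (mul_nonneg hN.le (hx j).1)).symm

variable [Fintype ι]

theorem cubeLebesgue_eq_map_pi :
    cubeLebesgue ι = (Measure.pi fun _ : ι => (volume : Measure ℝ).restrict (Icc 0 1)).map
      (WithLp.toLp 2) := by
  have h := (PiLp.volume_preserving_toLp ι).restrict_preimage_emb
    (MeasurableEquiv.toLp 2 (ι → ℝ)).measurableEmbedding (unitCube ι)
  have h' : WithLp.toLp 2 ⁻¹' unitCube ι = univ.pi fun _ : ι => Icc (0 : ℝ) 1 := by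
    ext x
    simp only [unitCube, mem_preimage, mem_ofPred_eq, mem_univ_pi]
  rw [h', volume_pi, Measure.restrict_pi_pi] at h
  exact h.map_eq.symm

instance : IsProbabilityMeasure ((volume : Measure ℝ).restrict (Icc 0 1)) := ⟨by simp⟩

instance : IsProbabilityMeasure (cubeLebesgue ι) := by
  rw [cubeLebesgue_eq_map_pi]
  exact Measure.isProbabilityMeasure_map (by fun_prop)

theorem map_coord_cubeLebesgue (j : ι) :
    (cubeLebesgue ι).map (fun x => x j) = (volume : Measure ℝ).restrict (Icc 0 1) := by
  rw [cubeLebesgue_eq_map_pi, Measure.map_map (by fun_prop) (by fun_prop)]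
  exact (measurePreserving_eval (fun _ : ι => (volume : Measure ℝ).restrict (Icc 0 1)) j).map_eq

theorem measurableSet_halfOpenCube : MeasurableSet (halfOpenCube ι) := by
  simp only [halfOpenCube, ofPred_forall]
  exact MeasurableSet.iInter fun j => measurableSet_Ico.preimage (by fun_prop)

/-- Allows the faces with a coordinate equal to `1`, where digit identities can fail, to be ignored.
-/
theorem ae_mem_halfOpenCube : ∀ᵐ x ∂cubeLebesgue ι, x ∈ halfOpenCube ι := by
  simp only [halfOpenCube, mem_ofPred_eq]
  refine ae_all_iff.2 fun j => ?_
  have h : ∀ᵐ y ∂(volume : Measure ℝ).restrict (Icc 0 1), y ∈ Ico (0 : ℝ) 1 := by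
    rw [← restrict_Ico_eq_restrict_Icc]
    exact ae_restrict_mem measurableSet_Ico
  rw [← map_coord_cubeLebesgue j] at h
  exact ae_of_ae_map (by fun_prop) h

theorem cubeLebesgue_eq_restrict_halfOpenCube :
    cubeLebesgue ι = volume.restrict (halfOpenCube ι) := by
  have h : halfOpenCube ι ⊆ unitCube ι := fun x hx j => ⟨(hx j).1, (hx j).2.le⟩
  rw [← Measure.restrict_eq_self_of_ae_mem (μ := cubeLebesgue ι) ae_mem_halfOpenCube, cubeLebesgue,
    Measure.restrict_restrict measurableSet_halfOpenCube, inter_eq_left.2 h]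

theorem map_gridMap_volume {N : ℕ} [NeZero N] (i : ι → Fin N) :
    (volume : Measure (EuclideanSpace ℝ ι)).map (gridMap i) =
      ENNReal.ofReal ((N : ℝ) ^ Fintype.card ι) • volume := by
  have hN : (N : ℝ)⁻¹ ≠ 0 := inv_ne_zero (Nat.cast_ne_zero.2 (NeZero.ne N))
  have : gridMap i = (gridMap i 0 + ·) ∘ ((N : ℝ)⁻¹ • ·) := gridMap_eq_fun i
  rw [this, ← Measure.map_map (by fun_prop) (by fun_prop), Measure.map_addHaar_smul _ hN,
    Measure.map_smul, map_add_left_eq_self, finrank_euclideanSpace, inv_pow, inv_inv,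
    abs_of_nonneg (by positivity)]

theorem measurableSet_gridCell {N : ℕ} (i : ι → Fin N) : MeasurableSet (gridCell i) := by
  simp only [gridCell, ofPred_forall]
  exact MeasurableSet.iInter fun j => measurableSet_Ico.preimage (by fun_prop)

/-- Each weighted image is Lebesgue measure on one half-open cell, and these cells tile the
half-open cube without overlap. -/
theorem sum_map_gridMap_cubeLebesgue {N : ℕ} [NeZero N] [DecidableEq ι] :
    ∑ i : ι → Fin N, ENNReal.ofReal (1 / (N : ℝ) ^ Fintype.card ι) •
      (cubeLebesgue ι).map (gridMap i) = cubeLebesgue ι := by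
  have hN : (0 : ℝ) < N := Nat.cast_pos.2 (NeZero.pos N)
  simp only [cubeLebesgue_eq_restrict_halfOpenCube]
  have h : ∀ i : ι → Fin N, ENNReal.ofReal (1 / (N : ℝ) ^ Fintype.card ι) •
      (volume.restrict (halfOpenCube ι)).map (gridMap i) = volume.restrict (gridCell i) := by
    intro i
    rw [← gridMap_preimage_gridCell i,
      ← Measure.restrict_map (continuous_gridMap i).measurable (measurableSet_gridCell i),
      map_gridMap_volume, Measure.restrict_smul, smul_smul, ← ENNReal.ofReal_mul (by positivity),
      one_div_mul_cancel (by positivity), ENNReal.ofReal_one, one_smul]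
  rw [Finset.sum_congr rfl fun i _ => h i, ← iUnion_gridCell (N := N),
    Measure.restrict_iUnion pairwise_disjoint_gridCell measurableSet_gridCell,
    Measure.sum_fintype]

end Lebesgue

/-! ### Base `N` digits and the balancing coordinate -/

section Digits

theorem ofDigits_eq_div {N : ℕ} (a : ℕ → Fin N) :
    Real.ofDigits a = ((a 0 : ℕ) + Real.ofDigits fun n => a (n + 1)) / N := by
  rw [Real.ofDigits_eq_sum_add_ofDigits a 1]
  simp [Real.ofDigitsTerm]
  ring

variable {N : ℕ} [NeZero N]

theorem digits_div_zero (i : Fin N) {x : ℝ} (hx : x ∈ Ico (0 : ℝ) 1) :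
    Real.digits (((i : ℕ) + x) / N) N 0 = i := by
  have hN : (N : ℝ) ≠ 0 := Nat.cast_ne_zero.2 (NeZero.ne N)
  have h : ⌊((i : ℕ) + x) / N * (N : ℝ) ^ (0 + 1)⌋₊ = i := by
    rw [zero_add, pow_one, div_mul_cancel₀ _ hN, add_comm, Nat.floor_add_natCast hx.1,
      Nat.floor_eq_zero.2 hx.2, zero_add]
  ext
  simp only [Real.digits, h, Fin.val_ofNat, Nat.mod_eq_of_lt i.2]

theorem digits_div_succ (i : Fin N) {x : ℝ} (hx : 0 ≤ x) (n : ℕ) :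
    Real.digits (((i : ℕ) + x) / N) N (n + 1) = Real.digits x N n := by
  have hN : (N : ℝ) ≠ 0 := Nat.cast_ne_zero.2 (NeZero.ne N)
  -- The leading digit adds a multiple of `N` to the floor, which disappears modulo `N`.
  have h : ((i : ℕ) + x) / N * (N : ℝ) ^ (n + 1 + 1) =
      x * (N : ℝ) ^ (n + 1) + ((i * N ^ n * N : ℕ) : ℝ) := by
    push_cast
    field_simp
    ring
  ext
  rw [Real.digits, h, Nat.floor_add_natCast (by positivity), Fin.val_ofNat, Nat.add_mul_mod_self_right,
    Real.digits, Fin.val_ofNat]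

theorem measurable_digits : Measurable fun x : ℝ => Real.digits x N := by
  refine measurable_pi_lambda _ fun n => ?_
  exact (measurable_of_countable (Fin.ofNat N)).comp
    (Nat.measurable_floor.comp (measurable_id.mul_const _))

/-- The number whose base `N` digits balance those of the coordinates of `y`, i.e. make all digit
sums vanish modulo `N`. -/
noncomputable def balancing (N : ℕ) [NeZero N] {ι : Type*} [Fintype ι] (y : EuclideanSpace ℝ ι) :
    ℝ :=
  Real.ofDigits fun n => -∑ k, Real.digits (y k) N n

variable {ι : Type*} [Fintype ι]

theorem balancing_mem_Icc (y : EuclideanSpace ℝ ι) : balancing N y ∈ Icc (0 : ℝ) 1 :=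
  ⟨Real.ofDigits_nonneg _, Real.ofDigits_le_one _⟩

theorem measurable_balancing : Measurable (balancing N : EuclideanSpace ℝ ι → ℝ) := by
  refine Real.continuous_ofDigits.measurable.comp (measurable_pi_lambda _ fun n => ?_)
  have h : Measurable fun y : EuclideanSpace ℝ ι => fun k => Real.digits (y k) N n :=
    measurable_pi_lambda _ fun k =>
      (measurable_pi_apply n).comp (measurable_digits.comp (by fun_prop))
  exact (measurable_of_countable fun a : ι → Fin N => -∑ k, a k).comp h

/-- A grid map prepends the digit `i k` to the coordinate `k` and shifts the others, so the
balancing number gets the balancing digit prepended. -/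
theorem balancing_gridMap (i : ι → Fin N) {y : EuclideanSpace ℝ ι} (hy : y ∈ halfOpenCube ι) :
    balancing N (gridMap i y) = (((-∑ k, i k : Fin N) : ℕ) + balancing N y) / N := by
  rw [balancing, ofDigits_eq_div]
  simp only [gridMap_apply, digits_div_zero _ (hy _), digits_div_succ _ (hy _).1]
  rfl

end Digits

/-! ### Existence: lifting Lebesgue measure -/

section Lift

variable {d N : ℕ} [NeZero N]

/-- The index with zero sum that extends `i`. -/
def completeIndex (j : Fin d) (i : {k : Fin d // k ≠ j} → Fin N) (k : Fin d) : Fin N :=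
  if h : k = j then -∑ m, i m else i ⟨k, h⟩

/-- The point that extends `y` by its balancing coordinate. -/
noncomputable def balancedLift (N : ℕ) [NeZero N] (j : Fin d)
    (y : EuclideanSpace ℝ {k : Fin d // k ≠ j}) : EuclideanSpace ℝ (Fin d) :=
  WithLp.toLp 2 fun k => if h : k = j then balancing N y else y ⟨k, h⟩

theorem dropCoord_balancedLift (j : Fin d) (y : EuclideanSpace ℝ {k : Fin d // k ≠ j}) :
    dropCoord j (balancedLift N j y) = y := by
  ext k
  simp [dropCoord, balancedLift, k.2]

theorem balancedLift_self (j : Fin d) (y : EuclideanSpace ℝ {k : Fin d // k ≠ j}) :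
    balancedLift N j y j = balancing N y := by
  simp [balancedLift]

theorem measurable_balancedLift (j : Fin d) :
    Measurable (balancedLift N j) := by
  refine (PiLp.continuous_toLp 2 _).measurable.comp (measurable_pi_lambda _ fun k => ?_)
  by_cases h : k = j
  · simpa [h] using measurable_balancing
  · simp only [h, dite_false]
    fun_prop

theorem continuous_dropCoord (j : Fin d) : Continuous (dropCoord j) := by
  unfold dropCoord
  fun_prop

theorem balancedLift_gridMap (j : Fin d) (i : {k : Fin d // k ≠ j} → Fin N)
    {y : EuclideanSpace ℝ {k : Fin d // k ≠ j}} (hy : y ∈ halfOpenCube _) :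
    balancedLift N j (gridMap i y) = gridMap (completeIndex j i) (balancedLift N j y) := by
  ext k
  by_cases h : k = j
  · simp [balancedLift, gridMap_apply, completeIndex, h, balancing_gridMap i hy]
  · simp [balancedLift, gridMap_apply, completeIndex, h]

theorem sum_completeIndex (j : Fin d) (i : {k : Fin d // k ≠ j} → Fin N) :
    ∑ k, completeIndex j i k = 0 := by
  rw [← Fintype.sum_subtype_add_sum_subtype (fun k => k ≠ j)]
  have h1 : ∀ k : {k : Fin d // k ≠ j}, completeIndex j i k = i k := fun k => by
    simp [completeIndex, k.2]
  have : Unique {k : Fin d // ¬ k ≠ j} := ⟨⟨⟨j, by simp⟩⟩, fun k => Subtype.ext (not_not.1 k.2)⟩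
  have h2 : ∀ k : {k : Fin d // ¬ k ≠ j}, completeIndex j i k = -∑ m, i m := fun k => by
    simp [completeIndex, not_not.1 k.2]
  simp [h1, h2]

theorem sum_zeroSumIndices {M : Type*} [AddCommMonoid M] (j : Fin d) (F : (Fin d → Fin N) → M) :
    ∑ i ∈ zeroSumIndices d N, F i = ∑ i, F (completeIndex j i) := by
  symm
  refine Finset.sum_bij' (fun i _ => completeIndex j i) (fun i _ k => i k)
    (fun i _ => mem_zeroSumIndices.2 (sum_completeIndex j i)) (fun _ _ => Finset.mem_univ _)
    (fun i _ => ?_) (fun i hi => ?_) (fun _ _ => rfl)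
  · ext k
    simp [completeIndex, k.2]
  · have hi' := mem_zeroSumIndices.1 hi
    rw [← Finset.add_sum_erase _ _ (Finset.mem_univ j), ← eq_neg_iff_add_eq_zero] at hi'
    ext k
    by_cases h : k = j
    · subst h
      rw [hi', completeIndex, dif_pos rfl,
        Finset.sum_subtype (Finset.univ.erase k) (p := fun m => m ≠ k) (by simp)]
    · simp [completeIndex, h]

theorem isInvariantMeasure_map_balancedLift (hd : 2 ≤ d) (j : Fin d) :
    IsInvariantMeasure (digitSumMatrix d N) ((cubeLebesgue _).map (balancedLift N j)) where
  isProbabilityMeasure :=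
    Measure.isProbabilityMeasure_map (measurable_balancedLift j).aemeasurable
  compl_cube := by
    rw [Measure.map_apply (measurable_balancedLift j) isClosed_unitCube.measurableSet.compl]
    refine measure_mono_null ?_ (mem_ae_iff.1 ae_mem_halfOpenCube)
    refine fun y hy hy' => hy fun k => ?_
    by_cases h : k = j
    · simpa [balancedLift, h] using balancing_mem_Icc y
    · simpa [balancedLift, h] using Ico_subset_Icc_self (hy' ⟨k, h⟩)
  fixed := by
    rw [markovOperator_digitSumMatrix hd, sum_zeroSumIndices j]
    -- Linearity of the push-forward allows a comparison term by term.
    conv_rhs => rw [← sum_map_gridMap_cubeLebesgue (N := N)]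
    have hm := measurable_balancedLift (N := N) j
    rw [← Measure.mapₗ_apply_of_measurable hm (Finset.sum _ _), map_sum]
    refine Finset.sum_congr rfl fun i _ => ?_
    have hdim : Fintype.card {k : Fin d // k ≠ j} = d - 1 := by simp
    rw [map_smul, Measure.mapₗ_apply_of_measurable hm, hdim,
      Measure.map_map (continuous_gridMap _).measurable hm,
      Measure.map_map hm (continuous_gridMap _).measurable]
    congr 1
    refine Measure.map_congr ?_
    filter_upwards [ae_mem_halfOpenCube] with y hy
    exact (balancedLift_gridMap j i hy).symm

end Lift

/-! ### Self-similarity of the support -/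

section SelfSimilarSupport

variable {X α : Type*} [TopologicalSpace X] [T2Space X] [HereditarilyLindelofSpace X]
  [MeasurableSpace X] [BorelSpace X]

/-- A compact support of a measure invariant under a weighted system of continuous maps is
invariant under the system. -/
theorem support_eq_iUnion_image {μ : Measure X} (s : Finset α) (c : α → ℝ≥0∞)
    (hc : ∀ a ∈ s, c a ≠ 0) {f : α → X → X} (hf : ∀ a, Continuous (f a))
    (hμ : ∑ a ∈ s, c a • μ.map (f a) = μ) (hK : IsCompact μ.support) :
    μ.support = ⋃ a ∈ s, f a '' μ.support := by
  have hμ' : ∀ A, MeasurableSet A → μ A = ∑ a ∈ s, c a * μ (f a ⁻¹' A) := by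
    intro A hA
    conv_lhs => rw [← hμ]
    simp only [Measure.coe_finsetSum, Finset.sum_apply, Measure.smul_apply, smul_eq_mul]
    exact Finset.sum_congr rfl fun a _ => by rw [Measure.map_apply (hf a).measurable hA]
  apply Subset.antisymm
  · have hcl : IsClosed (⋃ a ∈ s, f a '' μ.support) :=
      (s.isCompact_biUnion fun a _ => hK.image (hf a)).isClosed
    -- The complement of the union is null: its preimage under each `f a` misses the support.
    refine Measure.support_subset_of_isClosed hcl ?_
    rw [mem_ae_iff, hμ' _ hcl.measurableSet.compl]
    refine Finset.sum_eq_zero fun a ha => ?_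
    refine mul_eq_zero_of_right _ (measure_mono_null ?_ (Measure.measure_compl_support (μ := μ)))
    intro x hx hxs
    exact hx (mem_biUnion (Finset.mem_coe.2 ha) (mem_image_of_mem _ hxs))
  -- An open `u` around `f a x` has mass at least `c a * μ (f a ⁻¹' u)`, positive since `x` is in
  -- the support.
  · refine iUnion₂_subset fun a ha => image_subset_iff.2 fun x hx => ?_
    rw [mem_preimage, Measure.support_eq_forall_isOpen]
    intro u hxu hu
    rw [Measure.support_eq_forall_isOpen] at hx
    have h := hx (f a ⁻¹' u) hxu (hu.preimage (hf a))
    rw [hμ' u hu.measurableSet]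
    refine lt_of_lt_of_le (ENNReal.mul_pos (hc a ha) h.ne') ?_
    exact Finset.single_le_sum (f := fun a => c a * μ (f a ⁻¹' u)) (fun _ _ => zero_le) ha

end SelfSimilarSupport

/-! ### Hausdorff dimension bounds -/

section Dimension

open Filter Topology
open scoped NNReal

variable {X α : Type*} [EMetricSpace X]

theorem exists_cover_of_selfSimilar {K : Set X} {r : ℝ≥0} {f : α → X → X}
    (hf : ∀ a, LipschitzWith r (f a)) (hK : K ⊆ ⋃ a, f a '' K) (n : ℕ) :
    ∃ t : (Fin n → α) → Set X, K ⊆ ⋃ w, t w ∧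
      ∀ w, Metric.ediam (t w) ≤ (r : ℝ≥0∞) ^ n * Metric.ediam K := by
  induction n with
  | zero => exact ⟨fun _ => K, subset_iUnion_of_subset Fin.elim0 Subset.rfl, by simp⟩
  | succ n ih =>
    obtain ⟨t, hKt, ht⟩ := ih
    refine ⟨fun w => f (w 0) '' t (Fin.tail w), fun x hx => ?_, fun w => ?_⟩
    · obtain ⟨a, y, hy, rfl⟩ := mem_iUnion.1 (hK hx)
      obtain ⟨w, hw⟩ := mem_iUnion.1 (hKt hy)
      refine mem_iUnion.2 ⟨Fin.cons a w, ?_⟩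
      simpa using mem_image_of_mem (f a) hw
    · refine ((hf _).ediam_image_le _).trans ?_
      rw [pow_succ', mul_assoc]
      gcongr
      exact ht _

/-- A bounded set covered by `m` images of itself under maps with Lipschitz constant `r < 1` has
dimension at most `s` whenever `m * r ^ s ≤ 1`. -/
theorem dimH_le_of_selfSimilar [Fintype α] {K : Set X} (hKb : Metric.ediam K ≠ ∞) {r : ℝ≥0}
    (hr : r < 1) {f : α → X → X} (hf : ∀ a, LipschitzWith r (f a)) (hK : K ⊆ ⋃ a, f a '' K) {s : ℝ≥0}
    (hs : (Fintype.card α : ℝ≥0∞) * (r : ℝ≥0∞) ^ (s : ℝ) ≤ 1) : dimH K ≤ s := by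
  borelize X
  choose t hKt ht using exists_cover_of_selfSimilar hf hK
  have hlim : Tendsto (fun n : ℕ => (r : ℝ≥0∞) ^ n * Metric.ediam K) atTop (𝓝 0) := by
    have := ENNReal.Tendsto.mul_const (b := Metric.ediam K)
      (ENNReal.tendsto_pow_atTop_nhds_zero_of_lt_one (ENNReal.coe_lt_one_iff.2 hr)) (Or.inr hKb)
    rwa [zero_mul] at this
  -- As `m * r ^ s ≤ 1`, the `s`-sums of the level `n` covers stay below `ediam K ^ s`, so the
  -- `s`-dimensional measure is finite.
  have hle := Measure.hausdorffMeasure_le_liminf_sum (s : ℝ) K _ hlim t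
    (Eventually.of_forall ht) (Eventually.of_forall hKt)
  refine dimH_le_of_hausdorffMeasure_ne_top (ne_top_of_le_ne_top
    (ENNReal.rpow_ne_top_of_nonneg s.coe_nonneg hKb) (hle.trans ?_))
  refine (liminf_le_liminf (v := fun _ => Metric.ediam K ^ (s : ℝ))
    (Eventually.of_forall fun n => ?_)).trans (liminf_const _).le
  calc ∑ w, Metric.ediam (t n w) ^ (s : ℝ)
      ≤ ∑ _w : Fin n → α, ((r : ℝ≥0∞) ^ n * Metric.ediam K) ^ (s : ℝ) :=
        Finset.sum_le_sum fun w _ => ENNReal.rpow_le_rpow (ht n w) s.coe_nonneg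
    _ = (Fintype.card α * (r : ℝ≥0∞) ^ (s : ℝ)) ^ n * Metric.ediam K ^ (s : ℝ) := by
        have h : ((r : ℝ≥0∞) ^ n) ^ (s : ℝ) = ((r : ℝ≥0∞) ^ (s : ℝ)) ^ n := by
          rw [← ENNReal.rpow_natCast, ← ENNReal.rpow_natCast, ← ENNReal.rpow_mul,
            ← ENNReal.rpow_mul, mul_comm]
        rw [Finset.sum_const, Finset.card_univ, Fintype.card_fun, Fintype.card_fin, nsmul_eq_mul,
          ENNReal.mul_rpow_of_nonneg _ _ s.coe_nonneg, h, Nat.cast_pow, mul_pow, mul_assoc]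
    _ ≤ 1 * Metric.ediam K ^ (s : ℝ) := by
        gcongr
        exact pow_le_one₀ zero_le hs
    _ = Metric.ediam K ^ (s : ℝ) := one_mul _

end Dimension

theorem volume_eq_zero_of_dimH_lt {E : Type*} [NormedAddCommGroup E] [InnerProductSpace ℝ E]
    [FiniteDimensional ℝ E] [MeasurableSpace E] [BorelSpace E] {K : Set E}
    (hK : dimH K < Module.finrank ℝ E) : (volume : Measure E) K = 0 := by
  have := isAddHaarMeasure_hausdorffMeasure (E := E)
  refine Measure.absolutelyContinuous_isAddHaarMeasure volume
    (Measure.hausdorffMeasure (X := E) (Module.finrank ℝ E)) ?_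
  exact hausdorffMeasure_of_dimH_lt (d := (Module.finrank ℝ E : NNReal)) (by simpa using hK)

theorem dist_gridMap {ι : Type*} [Fintype ι] {N : ℕ} (i : ι → Fin N) (x y : EuclideanSpace ℝ ι) :
    dist (gridMap i x) (gridMap i y) = (N : ℝ)⁻¹ * dist x y := by
  rw [gridMap_eq_add_smul i x, gridMap_eq_add_smul i y, dist_add_left, dist_smul₀,
    Real.norm_of_nonneg (by positivity)]

theorem lipschitzWith_dropCoord {d : ℕ} (j : Fin d) : ∃ C, LipschitzWith C (dropCoord j) := by
  let T : EuclideanSpace ℝ (Fin d) →ₗ[ℝ] EuclideanSpace ℝ {k : Fin d // k ≠ j} :=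
    { toFun := dropCoord j, map_add' := fun _ _ => rfl, map_smul' := fun _ _ => rfl }
  exact ⟨_, T.toContinuousLinearMap.lipschitz⟩

/-- The projection of `K` is compact and has full measure in the cube, so it contains the open cube;
Lipschitz maps do not raise dimension. -/
theorem le_dimH_of_ae_mem {d : ℕ} {μ : Measure (EuclideanSpace ℝ (Fin d))} {j : Fin d}
    (hμ : μ.map (dropCoord j) = cubeLebesgue {k : Fin d // k ≠ j})
    {K : Set (EuclideanSpace ℝ (Fin d))} (hK : IsCompact K) (hμK : μ Kᶜ = 0) :
    ((d - 1 : ℕ) : ℝ≥0∞) ≤ dimH K := by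
  have hM : IsCompact (dropCoord j '' K) := hK.image (continuous_dropCoord j)
  set U : Set (EuclideanSpace ℝ {k : Fin d // k ≠ j}) := {y | ∀ k, y k ∈ Ioo (0 : ℝ) 1} with hU
  have hUo : IsOpen U := by
    simp only [hU, ofPred_forall]
    exact isOpen_iInter_of_finite fun k => isOpen_Ioo.preimage (by fun_prop)
  have hnull : volume (U ∩ (dropCoord j '' K)ᶜ) = 0 := by
    have h1 : cubeLebesgue _ (dropCoord j '' K)ᶜ = 0 := by
      rw [← hμ, Measure.map_apply (continuous_dropCoord j).measurable hM.measurableSet.compl]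
      exact measure_mono_null (fun x hx hxK => hx (mem_image_of_mem _ hxK)) hμK
    rw [cubeLebesgue, Measure.restrict_apply hM.measurableSet.compl] at h1
    refine measure_mono_null ?_ h1
    exact fun y hy => ⟨hy.2, fun k => Ioo_subset_Icc_self (hy.1 k)⟩
  have hUM : U ⊆ dropCoord j '' K := by
    -- An open null set is empty.
    rw [(hUo.inter hM.isClosed.isOpen_compl).measure_eq_zero_iff volume] at hnull
    rwa [← disjoint_compl_right_iff_subset, disjoint_iff_inter_eq_empty]
  have hUne : (interior U).Nonempty := by
    rw [hUo.interior_eq]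
    exact ⟨WithLp.toLp 2 fun _ => 1 / 2, fun k => by norm_num⟩
  obtain ⟨C, hC⟩ := lipschitzWith_dropCoord j
  calc ((d - 1 : ℕ) : ℝ≥0∞) = dimH U := by
        rw [Real.dimH_of_nonempty_interior hUne, finrank_euclideanSpace]
        simp
    _ ≤ dimH (dropCoord j '' K) := dimH_mono hUM
    _ ≤ dimH K := hC.dimH_image_le K

/-! ### Properties of the invariant measure -/

section Invariant

variable {d N : ℕ} {μ : Measure (EuclideanSpace ℝ (Fin d))}

theorem IsInvariantMeasure.isCompact_support
    (hμ : IsInvariantMeasure (digitSumMatrix d N) μ) : IsCompact μ.support := by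
  have hsub : μ.support ⊆ unitCube (Fin d) :=
    Measure.support_subset_of_isClosed isClosed_unitCube (mem_ae_iff.2 hμ.compl_cube)
  refine Metric.isCompact_of_isClosed_isBounded Measure.isClosed_support
    (Bornology.IsBounded.subset ?_ hsub)
  have h : IsCompact ((WithLp.toLp 2) '' (univ.pi fun _ : Fin d => Icc (0 : ℝ) 1)) :=
    (isCompact_univ_pi fun _ => isCompact_Icc).image (PiLp.continuous_toLp 2 _)
  exact h.isBounded.subset fun x hx => ⟨WithLp.ofLp x, fun k _ => hx k, rfl⟩

theorem IsInvariantMeasure.support_nonempty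
    (hμ : IsInvariantMeasure (digitSumMatrix d N) μ) : μ.support.Nonempty := by
  have := hμ.isProbabilityMeasure
  exact Measure.nonempty_support (IsProbabilityMeasure.ne_zero μ)

variable [NeZero N]

/-- By uniqueness the lifts along all coordinates agree, so each property can be read off along
whichever `j` suits it. -/
theorem IsInvariantMeasure.eq_map_balancedLift (hd : 2 ≤ d) (hN : 2 ≤ N)
    (hμ : IsInvariantMeasure (digitSumMatrix d N) μ) (j : Fin d) :
    μ = (cubeLebesgue _).map (balancedLift N j) := by
  have h := isInvariantMeasure_map_balancedLift (N := N) hd j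
  have := hμ.isProbabilityMeasure
  have := h.isProbabilityMeasure
  exact eq_of_markovOperator_eq hd hN hμ.fixed h.fixed

theorem IsInvariantMeasure.map_dropCoord (hd : 2 ≤ d) (hN : 2 ≤ N)
    (hμ : IsInvariantMeasure (digitSumMatrix d N) μ) (j : Fin d) :
    μ.map (dropCoord j) = cubeLebesgue _ := by
  rw [hμ.eq_map_balancedLift hd hN j, Measure.map_map (continuous_dropCoord j).measurable
    (measurable_balancedLift j)]
  have : dropCoord j ∘ balancedLift N j = id := funext (dropCoord_balancedLift j)
  rw [this, Measure.map_id]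

theorem IsInvariantMeasure.hasUniformMarginals (hd : 2 ≤ d) (hN : 2 ≤ N)
    (hμ : IsInvariantMeasure (digitSumMatrix d N) μ) : HasUniformMarginals μ where
  toIsCubeProbability := hμ.toIsCubeProbability
  map_coord j := by
    have : Nontrivial (Fin d) := Fin.nontrivial_iff_two_le.2 hd
    obtain ⟨j₀, hj₀⟩ := exists_ne j
    rw [← map_coord_cubeLebesgue (⟨j, hj₀.symm⟩ : {k : Fin d // k ≠ j₀}),
      ← hμ.map_dropCoord hd hN j₀,
      Measure.map_map (by fun_prop) (continuous_dropCoord j₀).measurable]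
    rfl
  map_dropCoord := hμ.map_dropCoord hd hN

theorem IsInvariantMeasure.ae_eq_balancing (hd : 2 ≤ d) (hN : 2 ≤ N)
    (hμ : IsInvariantMeasure (digitSumMatrix d N) μ) (j : Fin d) :
    ∀ᵐ x ∂μ, x j = balancing N (dropCoord j x) := by
  have hm : MeasurableSet {x : EuclideanSpace ℝ (Fin d) | x j = balancing N (dropCoord j x)} :=
    measurableSet_eq_fun (by fun_prop)
      (measurable_balancing.comp (continuous_dropCoord j).measurable)
  rw [hμ.eq_map_balancedLift hd hN j, ae_map_iff (measurable_balancedLift j).aemeasurable hm]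
  exact ae_of_all _ fun y => by rw [dropCoord_balancedLift, balancedLift_self]

theorem IsInvariantMeasure.support_eq_iUnion (hd : 2 ≤ d)
    (hμ : IsInvariantMeasure (digitSumMatrix d N) μ) :
    μ.support = ⋃ i ∈ zeroSumIndices d N, gridMap i '' μ.support := by
  have hN : (0 : ℝ) < N := Nat.cast_pos.2 (NeZero.pos N)
  refine support_eq_iUnion_image (zeroSumIndices d N)
    (fun _ => ENNReal.ofReal (1 / (N : ℝ) ^ (d - 1))) (fun _ _ => ?_) continuous_gridMap ?_
    hμ.isCompact_support
  · rw [Ne, ENNReal.ofReal_eq_zero, not_le]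
    positivity
  · rw [← markovOperator_digitSumMatrix hd, hμ.fixed]

theorem IsInvariantMeasure.support_eq_iUnion_subtype (hd : 2 ≤ d)
    (hμ : IsInvariantMeasure (digitSumMatrix d N) μ) :
    μ.support = ⋃ i : zeroSumIndices d N, gridMap i.1 '' μ.support := by
  rw [iUnion_subtype]
  exact hμ.support_eq_iUnion hd

theorem IsInvariantMeasure.isSelfSimilar_support (hd : 2 ≤ d) (hN : 2 ≤ N)
    (hμ : IsInvariantMeasure (digitSumMatrix d N) μ) : IsSelfSimilar μ.support := by
  have hN' : (1 : ℝ) < N := by exact_mod_cast hN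
  let e := (zeroSumIndices d N).equivFin
  refine ⟨hμ.support_nonempty, hμ.isCompact_support, (zeroSumIndices d N).card,
    fun l => gridMap (e.symm l).1, fun _ => (N : ℝ)⁻¹, ?_, fun l => ⟨by positivity,
    inv_lt_one_of_one_lt₀ hN', dist_gridMap _⟩, ?_⟩
  · rw [card_zeroSumIndices hd]
    exact hN.trans (Nat.le_self_pow (by omega) N)
  · conv_lhs => rw [hμ.support_eq_iUnion_subtype hd]
    exact (e.symm.surjective.iUnion_comp fun i => gridMap i.1 '' μ.support).symm

theorem IsInvariantMeasure.dimH_support (hd : 2 ≤ d) (hN : 2 ≤ N)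
    (hμ : IsInvariantMeasure (digitSumMatrix d N) μ) :
    dimH μ.support = ((d - 1 : ℕ) : ℝ≥0∞) := by
  refine le_antisymm ?_ (le_dimH_of_ae_mem (hμ.map_dropCoord hd hN ⟨0, by omega⟩)
    hμ.isCompact_support Measure.measure_compl_support)
  have hN' : (1 : NNReal) < N := by exact_mod_cast hN
  have h := dimH_le_of_selfSimilar (K := μ.support) (s := ((d - 1 : ℕ) : NNReal))
    (r := (N : NNReal)⁻¹) (f := fun i : zeroSumIndices d N => gridMap i.1)
    hμ.isCompact_support.isBounded.ediam_ne_top (inv_lt_one_of_one_lt₀ hN')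
    (fun i => LipschitzWith.of_dist_le_mul fun x y => by
      rw [dist_gridMap]
      simp)
    (hμ.support_eq_iUnion_subtype hd).subset ?_
  · simpa using h
  -- Equality holds here: `N ^ (d - 1)` maps of ratio `N⁻¹` in dimension `d - 1`.
  · rw [Fintype.card_coe, card_zeroSumIndices hd, NNReal.coe_natCast, ENNReal.rpow_natCast,
      ENNReal.coe_inv (by positivity), Nat.cast_pow, ENNReal.coe_natCast, ← mul_pow,
      ENNReal.mul_inv_cancel (by exact_mod_cast NeZero.ne N) (ENNReal.natCast_ne_top N), one_pow]

theorem IsInvariantMeasure.mutuallySingular_cubeLebesgue (hd : 2 ≤ d) (hN : 2 ≤ N)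
    (hμ : IsInvariantMeasure (digitSumMatrix d N) μ) :
    μ.MutuallySingular (cubeLebesgue (Fin d)) := by
  have hvol : (volume : Measure (EuclideanSpace ℝ (Fin d))) μ.support = 0 := by
    refine volume_eq_zero_of_dimH_lt ?_
    rw [hμ.dimH_support hd hN, finrank_euclideanSpace, Fintype.card_fin]
    exact_mod_cast (by omega : d - 1 < d)
  refine ⟨μ.supportᶜ, Measure.isClosed_support.measurableSet.compl,
    Measure.measure_compl_support, ?_⟩
  rw [compl_compl]
  exact Measure.absolutelyContinuous_of_le Measure.restrict_le_self hvol

end Invariant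

/-! ### The Sierpinski tetrahedron -/

section Tetrahedron

/-- The zero sum indices for `d = 3` and `N = 2`. -/
def tetrahedronIndex : Fin 4 → Fin 3 → Fin 2 :=
  ![![0, 0, 0], ![0, 1, 1], ![1, 0, 1], ![1, 1, 0]]

theorem zeroSumIndices_three_two : zeroSumIndices 3 2 = Finset.univ.image tetrahedronIndex := by
  decide

/-- The vertices of a regular tetrahedron inscribed in the unit cube. -/
noncomputable def tetrahedronVertex (v : Fin 4) : EuclideanSpace ℝ (Fin 3) :=
  WithLp.toLp 2 fun j => (tetrahedronIndex v j : ℝ)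

theorem gridMap_tetrahedronIndex (v : Fin 4) :
    gridMap (tetrahedronIndex v) = AffineMap.homothety (tetrahedronVertex v) (1 / 2 : ℝ) := by
  ext x j
  simp [gridMap_apply, AffineMap.homothety_apply, tetrahedronVertex]
  ring

theorem affineIndependent_tetrahedronVertex : AffineIndependent ℝ tetrahedronVertex := by
  rw [affineIndependent_iff_of_fintype]
  intro w hw h
  rw [Finset.weightedVSub_eq_linear_combination (hw := hw)] at h
  have h0 := congr_arg (fun x => x 0) h
  have h1 := congr_arg (fun x => x 1) h
  have h2 := congr_arg (fun x => x 2) h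
  -- The coordinates force the pairwise sums of `w 1`, `w 2`, `w 3` to vanish; the total weight then
  -- kills `w 0`.
  simp [Fin.sum_univ_four, tetrahedronVertex, tetrahedronIndex] at h0 h1 h2 hw
  intro v
  fin_cases v <;> simp <;> linarith

theorem isSierpinskiTetrahedron_support {μ : Measure (EuclideanSpace ℝ (Fin 3))}
    (hμ : IsInvariantMeasure (digitSumMatrix 3 2) μ) : IsSierpinskiTetrahedron μ.support := by
  refine ⟨⟨tetrahedronVertex, affineIndependent_tetrahedronVertex⟩, ⟨√2, fun v w hvw => ?_⟩,
    hμ.support_nonempty, hμ.isCompact_support, ?_⟩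
  -- Distinct vertices differ in exactly two coordinates, hence the edge length `√2`.
  · fin_cases v <;> fin_cases w <;>
      first
      | exact absurd rfl hvw
      | (simp [EuclideanSpace.dist_eq, Fin.sum_univ_three, tetrahedronVertex, tetrahedronIndex,
          Real.dist_eq]
         try norm_num)
  · conv_lhs => rw [hμ.support_eq_iUnion (by norm_num), zeroSumIndices_three_two]
    simp [gridMap_tetrahedronIndex]

end Tetrahedron

end SierpinskiCopula

/-! ### The main theorem -/

theorem theorem4p2 (d N : ℕ) (hd : 3 ≤ d) (hN : 2 ≤ N) :
    SierpinskiCopula.IsUniformMatrix (SierpinskiCopula.digitSumMatrix d N) ∧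
    (∃! μ : Measure (EuclideanSpace ℝ (Fin d)),
      SierpinskiCopula.IsInvariantMeasure (SierpinskiCopula.digitSumMatrix d N) μ) ∧
    ∀ μ : Measure (EuclideanSpace ℝ (Fin d)),
      SierpinskiCopula.IsInvariantMeasure (SierpinskiCopula.digitSumMatrix d N) μ →
        SierpinskiCopula.HasUniformMarginals μ ∧
        (μ.MutuallySingular (SierpinskiCopula.cubeLebesgue (Fin d)) ∧
          SierpinskiCopula.IsSelfSimilar μ.support ∧
          dimH μ.support = ((d - 1 : ℕ) : ℝ≥0∞)) ∧
        (∀ (Ω : Type u) [MeasurableSpace Ω] (P : Measure Ω) [IsProbabilityMeasure P]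
          (X : Ω → EuclideanSpace ℝ (Fin d)), ProbabilityTheory.HasLaw X μ P →
          ∀ j : Fin d, ∃ g : EuclideanSpace ℝ {k : Fin d // k ≠ j} → ℝ,
            Measurable g ∧ ∀ᵐ ω ∂P, X ω j = g (SierpinskiCopula.dropCoord j (X ω))) ∧
        (d = 3 → N = 2 → SierpinskiCopula.IsSierpinskiTetrahedron μ.support) := by
  have : NeZero N := ⟨by omega⟩
  have hd' : 2 ≤ d := by omega
  have hlift := SierpinskiCopula.isInvariantMeasure_map_balancedLift (N := N) hd'
    (⟨0, by omega⟩ : Fin d)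
  refine ⟨SierpinskiCopula.isUniformMatrix_digitSumMatrix hd',
    ⟨_, hlift, fun μ hμ => hμ.eq_map_balancedLift hd' hN _⟩, fun μ hμ =>
    ⟨hμ.hasUniformMarginals hd' hN, ⟨hμ.mutuallySingular_cubeLebesgue hd' hN,
      hμ.isSelfSimilar_support hd' hN, hμ.dimH_support hd' hN⟩, fun Ω _ P _ X hX j =>
      ⟨_, SierpinskiCopula.measurable_balancing (N := N), ?_⟩, ?_⟩⟩
  -- The same function `balancing` serves for every `j`; the relation passes from `μ` to `X` through
  -- its law.
  · have h := hμ.ae_eq_balancing hd' hN j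
    rw [← hX.map_eq] at h
    exact ae_of_ae_map hX.aemeasurable h
  · rintro rfl rfl
    exact SierpinskiCopula.isSierpinskiTetrahedron_support hμ
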